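/- Let $W_0$ and $W_{-1}$ be the two real branches of the Lambert $W$ function: $W_0$ is the inverse of $w\mapsto we^w$ restricted to $[-1,\infty)$, and $W_{-1}$ is the inverse of $w\mapsto we^w$ restricted to $(-\infty,-1]$. Let $\mathcal N(\mu_1,\Sigma_1)$, $\mathcal N(\mu_2,\Sigma_2)$, $\mathcal N(\mu_3,\Sigma_3)$ be three $n$-dimensional Gaussians with positive definite covariance matrices, and let $\varepsilon_1,\varepsilon_2\ge 0$ be real numbers that are not both zero. If $$KL(\mathcal N(\mu_1,\Sigma_1)\,\|\,\mathcal N(\mu_2,\Sigma_2))\le\varepsilon_1\quad\text{and}\quad KL(\mathcal N(\mu_2,\Sigma_2)\,\|\,\mathcal N(\mu_3,\Sigma_3))\le\varepsilon_2,$$ then $$\begin{aligned}KL(\mathcal N(\mu_1,\Sigma_1)\,\|\,\mathcal N(\mu_3,\Sigma_3))<{}&\varepsilon_1+\varepsilon_2+\frac12\Big\{W_{-1}(-e^{-(1+2\varepsilon_1)})\,W_{-1}(-e^{-(1+2\varepsilon_2)})+W_{-1}(-e^{-(1+2\varepsilon_1)})+W_{-1}(-e^{-(1+2\varepsilon_2)})+1\\&-W_{-1}(-e^{-(1+2\varepsilon_2)})\Big(\sqrt{2\varepsilon_1}+\sqrt{\frac{2\varepsilon_2}{-W_0(-e^{-(1+2\varepsilon_2)})}}\Big)^2\Big\}.\end{aligned}$$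 Here $KL$ is the Kullback-Leibler divergence. The bound does not depend on $n$. -/

import Mathlib

/-- The principal real branch `W₀` of the Lambert `W` function: the inverse of `w ↦ w * exp w`
restricted to `[-1, ∞)`. It is meaningful on `[-exp (-1), ∞)`. -/
noncomputable def lambertW0 (x : ℝ) : ℝ :=
  Function.invFunOn (fun w : ℝ => w * Real.exp w) (Set.Ici (-1)) x

/-- The real branch `W₋₁` of the Lambert `W` function: the inverse of `w ↦ w * exp w`
restricted to `(-∞, -1]`. It is meaningful on `[-exp (-1), 0)`. -/
noncomputable def lambertWNegOne (x : ℝ) : ℝ :=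
  Function.invFunOn (fun w : ℝ => w * Real.exp w) (Set.Iic (-1)) x

/-! Let `f x = x - 1 - log x`, R = √S₂, A = R⁻¹S₁R⁻¹, B = RS₃⁻¹R, and let u, v be the mean
differences multiplied by R⁻¹. The two hypotheses say tr A - log det A - n + |u|² ≤ 2ε₁ and tr B -
log det B - n + vᵀBv ≤ 2ε₂. Twice the target divergence exceeds the sum of these left sides by
tr((B-1)(A-1)) plus (u+v)ᵀB(u+v) - |u|² - vᵀBv. With aᵢ = -W₋₁(-e^{-(1+2εᵢ)}), the root ≥ 1 of `f a
= 2εᵢ`, Cauchy-Schwarz bounds the trace by (a₁-1)(a₂-1): the eigenvalues l satisfy ∑ f(l) ≤ f(a),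
and (x-1)²/f(x) is increasing, so ∑ (l-1)² ≤ (a-1)² in every dimension (`sq_mul_sub_log_le`,
`sum_sub_one_sq_le`). The quadratic part is controlled by B ≤ a₂ (`sq_add_sub_lt`), which also gives
strictness. Of W₀ only 0 < -W₀ ≤ 1 is needed. -/

/-! ### Real branches of Lambert W -/

open Real in
theorem exists_mul_exp_eq_of_le_neg_one {T : ℝ} (hT : 0 ≤ T) :
    ∃ w ∈ Set.Iic (-1 : ℝ), w * exp w = -exp (-(1 + T)) := by
  have hcont : ContinuousOn (fun w : ℝ => w * exp w) (Set.Icc (-(2 * T + 4)) (-1)) := by fun_prop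
  have hle : -(2 * T + 4) ≤ (-1 : ℝ) := by linarith
  -- The left endpoint works because 2T + 4 ≤ e^{T+2}, whence (2T+4)e^{-(2T+4)} ≤ e^{-(T+2)}.
  have hmem : -exp (-(1 + T)) ∈ Set.Icc ((-1 : ℝ) * exp (-1)) (-(2 * T + 4) * exp (-(2 * T + 4))) := by
    constructor
    · have : exp (-(1 + T)) ≤ exp (-1) := exp_le_exp.2 (by linarith)
      linarith
    · have h1 : T + 2 ≤ exp (T + 1) := by linarith [add_one_le_exp (T + 1)]
      have h2 : (2 : ℝ) ≤ exp 1 := by linarith [add_one_le_exp (1 : ℝ)]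
      have h3 : 2 * T + 4 ≤ exp (T + 2) := by
        have : exp (T + 2) = exp (T + 1) * exp 1 := by rw [← exp_add]; ring_nf
        rw [this]; nlinarith
      have h4 : exp (-(2 * T + 4)) * exp (T + 2) = exp (-(T + 2)) := by rw [← exp_add]; ring_nf
      have h5 : exp (-(T + 2)) ≤ exp (-(1 + T)) := exp_le_exp.2 (by linarith)
      nlinarith [exp_pos (-(2 * T + 4))]
  obtain ⟨w, hw, h⟩ := intermediate_value_Icc' hle hcont hmem
  exact ⟨w, hw.2, h⟩

open Real in
theorem exists_mul_exp_eq_of_neg_one_le {T : ℝ} (hT : 0 ≤ T) :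
    ∃ w ∈ Set.Ici (-1 : ℝ), w * exp w = -exp (-(1 + T)) := by
  have hcont : ContinuousOn (fun w : ℝ => w * exp w) (Set.Icc (-1) 0) := by fun_prop
  have hmem : -exp (-(1 + T)) ∈ Set.Icc ((-1 : ℝ) * exp (-1)) (0 * exp 0) := by
    constructor
    · have : exp (-(1 + T)) ≤ exp (-1) := exp_le_exp.2 (by linarith)
      linarith
    · linarith [exp_pos (-(1 + T))]
  obtain ⟨w, hw, h⟩ := intermediate_value_Icc (by norm_num) hcont hmem
  exact ⟨w, hw.1, h⟩

open Real in
theorem lambertW0_mem {T : ℝ} (hT : 0 ≤ T) :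
    0 < -lambertW0 (-exp (-(1 + T))) ∧ -lambertW0 (-exp (-(1 + T))) ≤ 1 := by
  have h1 := Function.invFunOn_mem (exists_mul_exp_eq_of_neg_one_le hT)
  have h2 := Function.invFunOn_eq (exists_mul_exp_eq_of_neg_one_le hT)
  change lambertW0 _ ∈ _ at h1
  change lambertW0 _ * exp (lambertW0 _) = _ at h2
  refine ⟨?_, by linarith [Set.mem_Ici.1 h1]⟩
  by_contra! h
  have := exp_pos (-(1 + T))
  have : 0 ≤ lambertW0 (-exp (-(1 + T))) * exp (lambertW0 (-exp (-(1 + T)))) :=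
    mul_nonneg (by linarith) (exp_pos _).le
  linarith

open Real in
theorem lambertWNegOne_spec {T : ℝ} (hT : 0 ≤ T) :
    1 ≤ -lambertWNegOne (-exp (-(1 + T))) ∧
      -lambertWNegOne (-exp (-(1 + T))) - 1 - log (-lambertWNegOne (-exp (-(1 + T)))) = T := by
  have h1 := Function.invFunOn_mem (exists_mul_exp_eq_of_le_neg_one hT)
  have h2 := Function.invFunOn_eq (exists_mul_exp_eq_of_le_neg_one hT)
  change lambertWNegOne _ ∈ _ at h1
  change lambertWNegOne _ * exp (lambertWNegOne _) = _ at h2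
  set w := lambertWNegOne (-exp (-(1 + T)))
  have h3 : w ≤ -1 := h1
  refine ⟨by linarith, ?_⟩
  have h4 : log (-w * exp w) = -(1 + T) := by
    rw [neg_mul, h2, neg_neg, log_exp]
  rw [log_mul (by linarith) (exp_pos _).ne', log_exp] at h4
  linarith

/-! ### Scalar inequalities for x - 1 - log x -/

-- Monotonicity of (x-1)²/(x-1-log x), with denominators cleared so that x = 1 and a = 1 are
-- allowed. Both arguments are moved from 1 along segments, 1 + s(x-1) and 1 + s(a-1); the
-- difference `H` vanishes at s = 0 and its derivative has the sign of a - x.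
open Real in
theorem sq_mul_sub_log_le {x a : ℝ} (hx : 0 < x) (hxa : x ≤ a) :
    (x - 1) ^ 2 * (a - 1 - log a) ≤ (a - 1) ^ 2 * (x - 1 - log x) := by
  have pos {y s : ℝ} (hy : 0 < y) (h0 : 0 ≤ s) (h1 : s ≤ 1) : 0 < 1 + s * (y - 1) := by
    rcases h0.eq_or_lt with rfl | h0
    · simp
    · nlinarith [mul_pos h0 hy]
  have ha : 0 < a := hx.trans_le hxa
  let H : ℝ → ℝ := fun s => (a - 1) ^ 2 * (s * (x - 1) - log (1 + s * (x - 1)))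
    - (x - 1) ^ 2 * (s * (a - 1) - log (1 + s * (a - 1)))
  have hd {y s : ℝ} (hy : 0 < y) (h0 : 0 ≤ s) (h1 : s ≤ 1) :
      HasDerivAt (fun s => s * (y - 1) - log (1 + s * (y - 1)))
        ((y - 1) - (y - 1) / (1 + s * (y - 1))) s := by
    have h := (hasDerivAt_id s).mul_const (y - 1)
    rw [one_mul] at h
    exact h.sub ((h.const_add 1).log (pos hy h0 h1).ne')
  have hH {s : ℝ} (h0 : 0 ≤ s) (h1 : s ≤ 1) :=
    ((hd hx h0 h1).const_mul ((a - 1) ^ 2)).sub ((hd ha h0 h1).const_mul ((x - 1) ^ 2))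
  have hmono : MonotoneOn H (Set.Icc 0 1) := by
    apply monotoneOn_of_deriv_nonneg (convex_Icc 0 1)
    · exact fun s hs => (hH hs.1 hs.2).continuousAt.continuousWithinAt
    · intro s hs
      rw [interior_Icc] at hs
      exact (hH hs.1.le hs.2.le).differentiableAt.differentiableWithinAt
    · intro s hs
      rw [interior_Icc] at hs
      refine le_of_le_of_eq ?_ (hH hs.1.le hs.2.le).deriv.symm
      have p1 := pos hx hs.1.le hs.2.le
      have p2 := pos ha hs.1.le hs.2.le
      have : (a - 1) ^ 2 * (x - 1 - (x - 1) / (1 + s * (x - 1)))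
          - (x - 1) ^ 2 * (a - 1 - (a - 1) / (1 + s * (a - 1)))
          = (a - 1) ^ 2 * (x - 1) ^ 2 * s ^ 2 * (a - x)
            / ((1 + s * (x - 1)) * (1 + s * (a - 1))) := by
        have p1' := p1.ne'
        have p2' := p2.ne'
        rw [sub_div' p1', sub_div' p2', mul_div_assoc', mul_div_assoc', div_sub_div _ _ p1' p2']
        ring
      rw [this]
      have := sub_nonneg.2 hxa
      positivity
  have h01 := hmono (Set.left_mem_Icc.2 zero_le_one) (Set.right_mem_Icc.2 zero_le_one) zero_le_one
  simp only [H, zero_mul, add_zero, log_one, sub_zero, mul_zero, one_mul, add_sub_cancel] at h01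
  linarith

open Real in
theorem le_of_sub_log_le {x a : ℝ} (ha : 1 ≤ a) (hx : 0 < x)
    (h : x - 1 - log x ≤ a - 1 - log a) : x ≤ a := by
  by_contra! hlt
  have h1 : log (x / a) < x / a - 1 :=
    log_lt_sub_one_of_pos (by positivity) (by rw [Ne, div_eq_one_iff_eq (by linarith)]; exact hlt.ne')
  rw [log_div hx.ne' (by linarith)] at h1
  have h2 : x / a - 1 ≤ x - a := by
    rw [div_sub_one (by linarith)]
    exact div_le_self (by linarith) ha
  linarith

open Real in
theorem sub_log_nonneg {x : ℝ} (hx : 0 < x) : 0 ≤ x - 1 - log x := by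
  linarith [log_le_sub_one_of_pos hx]

open Real in
theorem sum_sub_one_sq_le {ι : Type*} [Fintype ι] {l : ι → ℝ} {a : ℝ} (ha : 1 ≤ a)
    (hl : ∀ i, 0 < l i) (h : ∑ i, (l i - 1 - log (l i)) ≤ a - 1 - log a) :
    (∀ i, l i ≤ a) ∧ ∑ i, (l i - 1) ^ 2 ≤ (a - 1) ^ 2 := by
  have hi (i : ι) : l i - 1 - log (l i) ≤ a - 1 - log a :=
    (Finset.single_le_sum (f := fun i => l i - 1 - log (l i))
      (fun i _ => sub_log_nonneg (hl i)) (Finset.mem_univ i)).trans h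
  have hle (i : ι) : l i ≤ a := le_of_sub_log_le ha (hl i) (hi i)
  refine ⟨hle, ?_⟩
  -- The argument cancels a - 1 - log a; when that is zero, every l i must equal 1.
  rcases (sub_log_nonneg (zero_lt_one.trans_le ha)).eq_or_lt with h0 | h0
  · have (i : ι) : l i = 1 := by
      by_contra hne
      linarith [hi i, log_lt_sub_one_of_pos (hl i) hne]
    simp only [this, sub_self]
    simp
    positivity
  · refine le_of_mul_le_mul_right ?_ h0
    calc (∑ i, (l i - 1) ^ 2) * (a - 1 - log a)
        = ∑ i, (l i - 1) ^ 2 * (a - 1 - log a) := Finset.sum_mul ..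
      _ ≤ ∑ i, (a - 1) ^ 2 * (l i - 1 - log (l i)) :=
          Finset.sum_le_sum fun i _ => sq_mul_sub_log_le (hl i) (hle i)
      _ = (a - 1) ^ 2 * ∑ i, (l i - 1 - log (l i)) := (Finset.mul_sum ..).symm
      _ ≤ _ := by gcongr

/-! ### Gaussian densities and the Kullback-Leibler formula -/

-- Both sides are finite measures with the same characteristic function. The normalizing constant
-- sits inside the exponential so that log-likelihood ratios become differences of exponents.
open MeasureTheory ProbabilityTheory in
theorem stdGaussian_eq_withDensity (E : Type*) [NormedAddCommGroup E] [InnerProductSpace ℝ E]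
    [FiniteDimensional ℝ E] [MeasurableSpace E] [BorelSpace E] :
    stdGaussian E = (volume : Measure E).withDensity fun x =>
      ENNReal.ofReal (Real.exp (-(Module.finrank ℝ E / 2 * Real.log (2 * Real.pi))
        - ‖x‖ ^ 2 / 2)) := by
  set c : ℝ := -(Module.finrank ℝ E / 2 * Real.log (2 * Real.pi)) with hc
  have hb : 0 < ((1 / 2 : ℝ) : ℂ).re := by norm_num
  have hint : Integrable fun x : E => Real.exp (c - ‖x‖ ^ 2 / 2) := by
    have h := ((GaussianFourier.integrable_cexp_neg_mul_sq_norm_add hb 0 (0 : E)).norm).const_mul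
      (Real.exp c)
    refine h.congr (Filter.Eventually.of_forall fun x => ?_)
    simp only [Complex.norm_exp, ← Real.exp_add]
    congr 1
    simp [← Complex.ofReal_pow]
    ring
  have : IsFiniteMeasure ((volume : Measure E).withDensity fun x =>
      ENNReal.ofReal (Real.exp (c - ‖x‖ ^ 2 / 2))) := isFiniteMeasure_withDensity_ofReal hint.2
  apply Measure.ext_of_charFun
  ext t
  rw [charFun_stdGaussian, charFun_apply, integral_withDensity_eq_integral_toReal_smul
    (by fun_prop) (by simp)]
  have key := GaussianFourier.integral_cexp_neg_mul_sq_norm_add hb Complex.I t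
  have hpi : ((Real.pi : ℂ) / ((1 / 2 : ℝ) : ℂ)) ^ (Module.finrank ℝ E / 2 : ℂ)
      = Complex.exp (-c) := by
    have h2 : (Real.pi : ℂ) / ((1 / 2 : ℝ) : ℂ) = ((2 * Real.pi : ℝ) : ℂ) := by
      push_cast; ring
    rw [h2, Complex.cpow_def_of_ne_zero (by exact_mod_cast (by positivity : 2 * Real.pi ≠ 0)),
      ← Complex.ofReal_log (by positivity), hc]
    congr 1
    push_cast
    ring
  rw [hpi] at key
  have heq : ∀ x : E, (ENNReal.ofReal (Real.exp (c - ‖x‖ ^ 2 / 2))).toReal •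
      Complex.exp ((inner ℝ x t : ℝ) * Complex.I) = Complex.exp c *
        Complex.exp (-((1 / 2 : ℝ) : ℂ) * ‖x‖ ^ 2 + Complex.I * (inner ℝ t x : ℝ)) := by
    intro x
    rw [ENNReal.toReal_ofReal (Real.exp_pos _).le, Complex.real_smul, Complex.ofReal_exp,
      ← Complex.exp_add, ← Complex.exp_add, real_inner_comm]
    congr 1
    push_cast
    ring
  simp_rw [heq]
  rw [integral_const_mul, key, ← Complex.exp_add, ← Complex.exp_add]
  congr 1
  push_cast
  rw [Complex.I_sq]
  ring

open scoped MatrixOrder in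
theorem Matrix.PosDef.cfcSqrt_spec {n : Type*} [Fintype n] [DecidableEq n] {S : Matrix n n ℝ}
    (hS : S.PosDef) : (CFC.sqrt S).transpose = CFC.sqrt S ∧ CFC.sqrt S * CFC.sqrt S = S ∧
      0 < (CFC.sqrt S).det := by
  have h1 : (CFC.sqrt S).PosSemidef := Matrix.nonneg_iff_posSemidef.1 (CFC.sqrt_nonneg S)
  have h2 : CFC.sqrt S * CFC.sqrt S = S := CFC.sqrt_mul_sqrt_self S hS.posSemidef.nonneg
  refine ⟨by simpa [Matrix.conjTranspose_eq_transpose_of_trivial] using h1.isHermitian.eq, h2, ?_⟩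
  refine h1.det_nonneg.lt_of_ne' fun h0 => ?_
  have := hS.det_pos
  rw [← h2, Matrix.det_mul, h0] at this
  simp at this

-- Change of variables along x ↦ m + √S x, which defines the measure; the Jacobian det √S accounts
-- for the term log det S / 2.
open MeasureTheory ProbabilityTheory Matrix in
open scoped MatrixOrder in
theorem multivariateGaussian_eq_withDensity {ι : Type*} [Fintype ι] [DecidableEq ι]
    (m : EuclideanSpace ℝ ι) {S : Matrix ι ι ℝ} (hS : S.PosDef) :
    multivariateGaussian m S = (volume : Measure (EuclideanSpace ℝ ι)).withDensity fun x =>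
      ENNReal.ofReal (Real.exp (-(Fintype.card ι / 2 * Real.log (2 * Real.pi))
        - Real.log S.det / 2 - (x - m).ofLp ⬝ᵥ S⁻¹ *ᵥ (x - m).ofLp / 2)) := by
  obtain ⟨hsymm, hsq, hdet⟩ := hS.cfcSqrt_spec
  set R := CFC.sqrt S
  set q : EuclideanSpace ℝ ι → ENNReal := fun x =>
    ENNReal.ofReal (Real.exp (-(Fintype.card ι / 2 * Real.log (2 * Real.pi))
        - Real.log S.det / 2 - (x - m).ofLp ⬝ᵥ S⁻¹ *ᵥ (x - m).ofLp / 2)) with hq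
  have hqm : Measurable q := by
    have : Measurable fun x : EuclideanSpace ℝ ι => (x - m).ofLp ⬝ᵥ S⁻¹ *ᵥ (x - m).ofLp := by
      simp only [dotProduct, mulVec]
      fun_prop
    fun_prop
  have hR : R * S⁻¹ * R = 1 := by
    rw [← hsq, Matrix.mul_inv_rev, ← mul_assoc, Matrix.mul_nonsing_inv _ hdet.ne'.isUnit, one_mul,
      Matrix.nonsing_inv_mul _ hdet.ne'.isUnit]
  have hquad (x : EuclideanSpace ℝ ι) :
      (toEuclideanCLM (𝕜 := ℝ) R x).ofLp ⬝ᵥ S⁻¹ *ᵥ (toEuclideanCLM (𝕜 := ℝ) R x).ofLp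
        = ‖x‖ ^ 2 := by
    rw [ofLp_toEuclideanCLM, dotProduct_mulVec, vecMul_mulVec, hsymm, ← dotProduct_mulVec,
      mulVec_mulVec, hR, one_mulVec, EuclideanSpace.real_norm_sq_eq]
    simp [dotProduct, sq]
  have hp (x : EuclideanSpace ℝ ι) : ENNReal.ofReal (Real.exp
      (-(Module.finrank ℝ (EuclideanSpace ℝ ι) / 2 * Real.log (2 * Real.pi)) - ‖x‖ ^ 2 / 2))
      = ENNReal.ofReal R.det * q (m + toEuclideanCLM (𝕜 := ℝ) R x) := by
    simp only [hq]
    rw [add_sub_cancel_left, hquad, ← ENNReal.ofReal_mul hdet.le, ← hsq, Matrix.det_mul,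
      Real.log_mul hdet.ne' hdet.ne']
    have hexp (y : ℝ) : R.det * Real.exp y = Real.exp (Real.log R.det + y) := by
      rw [Real.exp_add, Real.exp_log hdet]
    rw [hexp, finrank_euclideanSpace]
    ring_nf
  have hdetLin : LinearMap.det (toEuclideanLin (𝕜 := ℝ) R) = R.det := by
    rw [toEuclideanLin_eq_toLin_orthonormal, LinearMap.det_toLin]
  have hmap := Measure.map_linearMap_addHaar_eq_smul_addHaar
    (volume : Measure (EuclideanSpace ℝ ι)) (f := (toEuclideanLin (𝕜 := ℝ) R)) (by
      rw [hdetLin]; exact hdet.ne')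
  rw [hdetLin] at hmap
  have hcv {F : EuclideanSpace ℝ ι → ENNReal} (hF : Measurable F) :
      ENNReal.ofReal R.det * ∫⁻ x, F (m + toEuclideanCLM (𝕜 := ℝ) R x) = ∫⁻ x, F x := by
    have hF' : Measurable fun x => F (m + x) := by fun_prop
    have h1 : ∫⁻ x, F (m + toEuclideanCLM (𝕜 := ℝ) R x)
        = ∫⁻ x, F (m + x) ∂(Measure.map (toEuclideanLin (𝕜 := ℝ) R) volume) := by
      rw [lintegral_map hF' (LinearMap.continuous_of_finiteDimensional _).measurable]
      rfl
    rw [h1, hmap, lintegral_smul_measure, lintegral_add_left_eq_self F m, smul_eq_mul, ← mul_assoc,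
      ← ENNReal.ofReal_mul hdet.le, abs_of_pos (inv_pos.2 hdet), mul_inv_cancel₀ hdet.ne']
    simp
  ext s hs
  have hg : Measurable fun x : EuclideanSpace ℝ ι => m + toEuclideanCLM (𝕜 := ℝ) R x := by fun_prop
  rw [multivariateGaussian, Measure.map_apply hg hs, stdGaussian_eq_withDensity,
    withDensity_apply _ (hg hs), withDensity_apply _ hs, ← lintegral_indicator (hg hs),
    ← lintegral_indicator hs, ← hcv (hqm.indicator hs), ← lintegral_const_mul _ (by fun_prop)]
  congr 1 with x
  by_cases hx : m + toEuclideanCLM (𝕜 := ℝ) R x ∈ s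
  · rw [Set.indicator_of_mem (by exact hx), Set.indicator_of_mem hx, hp]
  · rw [Set.indicator_of_notMem (by exact hx), Set.indicator_of_notMem hx, mul_zero]

open MeasureTheory Real in
theorem llr_withDensity_exp {α : Type*} [MeasurableSpace α] {ρ μ ν : Measure α} [SigmaFinite ν]
    {P Q : α → ℝ} (hP : Measurable P) (hQ : Measurable Q)
    (hμ : μ = ρ.withDensity fun x => ENNReal.ofReal (exp (P x)))
    (hν : ν = ρ.withDensity fun x => ENNReal.ofReal (exp (Q x))) :
    μ.AbsolutelyContinuous ν ∧ llr μ ν =ᵐ[μ] fun x => P x - Q x := by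
  have h : μ = ν.withDensity fun x => ENNReal.ofReal (exp (P x - Q x)) := by
    rw [hν, ← withDensity_mul _ (by fun_prop) (by fun_prop), hμ]
    congr 1 with x
    rw [Pi.mul_apply, ← ENNReal.ofReal_mul (exp_pos _).le, ← exp_add]
    ring_nf
  have hac : μ.AbsolutelyContinuous ν := h ▸ withDensity_absolutelyContinuous ..
  refine ⟨hac, ?_⟩
  have hd := Measure.rnDeriv_withDensity ν
    (f := fun x => ENNReal.ofReal (exp (P x - Q x))) (by fun_prop)
  rw [← h] at hd
  filter_upwards [hac.ae_le hd] with x hx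
  rw [llr_def]
  simp only
  rw [hx, ENNReal.toReal_ofReal (exp_pos _).le, log_exp]

open MeasureTheory ProbabilityTheory Matrix in
theorem integral_quadratic_multivariateGaussian {ι : Type*} [Fintype ι] [DecidableEq ι]
    (m a : EuclideanSpace ℝ ι) {S : Matrix ι ι ℝ} (hS : S.PosSemidef) (M : Matrix ι ι ℝ) :
    Integrable (fun x : EuclideanSpace ℝ ι => (x - a).ofLp ⬝ᵥ M *ᵥ (x - a).ofLp)
      (multivariateGaussian m S) ∧
    ∫ x, (x - a).ofLp ⬝ᵥ M *ᵥ (x - a).ofLp ∂(multivariateGaussian m S)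
      = (M * S).trace + (m - a).ofLp ⬝ᵥ M *ᵥ (m - a).ofLp := by
  have hX (i : ι) : MemLp (fun x : EuclideanSpace ℝ ι => x i) 2 (multivariateGaussian m S) :=
    IsGaussian.memLp_two_id.continuousLinearMap_comp (EuclideanSpace.proj (𝕜 := ℝ) i)
  have hY (i : ι) : MemLp (fun x : EuclideanSpace ℝ ι => x i - a i) 2 (multivariateGaussian m S) :=
    (hX i).sub (memLp_const _)
  have hmean (i : ι) : ∫ x, (x i - a i) ∂(multivariateGaussian m S) = m i - a i := by
    rw [integral_sub ((hX i).integrable (by norm_num)) (integrable_const _)]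
    have := (EuclideanSpace.proj (𝕜 := ℝ) i).integral_comp_comm
      (IsGaussian.integrable_id (μ := multivariateGaussian m S))
    simp only [id, integral_id_multivariateGaussian] at this
    refine congrArg₂ _ this ?_
    simp
  have hint (i j : ι) : Integrable (fun x : EuclideanSpace ℝ ι => (x i - a i) * (x j - a j))
      (multivariateGaussian m S) := (hY i).integrable_mul (hY j)
  have hval (i j : ι) : ∫ x, (x i - a i) * (x j - a j) ∂(multivariateGaussian m S)
      = S i j + (m i - a i) * (m j - a j) := by
    have h := covariance_eq_sub (hY i) (hY j)
    rw [hmean, hmean, covariance_sub_const_left, covariance_sub_const_right,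
      covariance_eval_multivariateGaussian hS] at h
    · simp only [Pi.mul_apply] at h
      linarith
    · exact (hX j).integrable (by norm_num)
    · exact (hX i).integrable (by norm_num)
  have hexp (x : EuclideanSpace ℝ ι) : (x - a).ofLp ⬝ᵥ M *ᵥ (x - a).ofLp
      = ∑ i, ∑ j, M i j * ((x i - a i) * (x j - a j)) := by
    simp only [dotProduct, mulVec, Finset.mul_sum, PiLp.sub_apply]
    exact Finset.sum_congr rfl fun i _ => Finset.sum_congr rfl fun j _ => by ring
  have hfun : (fun x : EuclideanSpace ℝ ι => (x - a).ofLp ⬝ᵥ M *ᵥ (x - a).ofLp)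
      = fun x => ∑ i, ∑ j, M i j * ((x i - a i) * (x j - a j)) := funext hexp
  rw [hfun, hexp]
  refine ⟨integrable_finsetSum _ fun i _ => integrable_finsetSum _ fun j _ =>
    (hint i j).const_mul _, ?_⟩
  have hsum : ∫ x : EuclideanSpace ℝ ι, ∑ i, ∑ j, M i j * ((x i - a i) * (x j - a j))
      ∂(multivariateGaussian m S)
      = ∑ i, ∑ j, M i j * (S i j + (m i - a i) * (m j - a j)) := by
    refine (integral_finsetSum _ fun i _ => integrable_finsetSum _ fun j _ =>
      (hint i j).const_mul _).trans (Finset.sum_congr rfl fun i _ => ?_)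
    refine (integral_finsetSum _ fun j _ => (hint i j).const_mul _).trans
      (Finset.sum_congr rfl fun j _ => ?_)
    rw [integral_const_mul, hval]
  rw [hsum]
  simp only [mul_add, Finset.sum_add_distrib]
  congr 1
  simp only [trace, diag_apply, mul_apply]
  refine Finset.sum_congr rfl fun i _ => Finset.sum_congr rfl fun j _ => ?_
  -- The trace of M * S pairs M i j with S j i, so symmetry of the covariance is needed.
  rw [show S j i = S i j by simpa using hS.isHermitian.apply i j]

open MeasureTheory ProbabilityTheory Matrix in
theorem klDiv_multivariateGaussian {ι : Type*} [Fintype ι] [DecidableEq ι]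
    (m₁ m₂ : EuclideanSpace ℝ ι) {S₁ S₂ : Matrix ι ι ℝ} (hS₁ : S₁.PosDef) (hS₂ : S₂.PosDef) :
    InformationTheory.klDiv (multivariateGaussian m₁ S₁) (multivariateGaussian m₂ S₂)
      = ENNReal.ofReal (1 / 2 * (Real.log S₂.det - Real.log S₁.det + (S₂⁻¹ * S₁).trace
        - Fintype.card ι + (m₁ - m₂).ofLp ⬝ᵥ S₂⁻¹ *ᵥ (m₁ - m₂).ofLp)) := by
  have hmeas (m : EuclideanSpace ℝ ι) (S : Matrix ι ι ℝ) : Measurable fun x =>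
      -(Fintype.card ι / 2 * Real.log (2 * Real.pi)) - Real.log S.det / 2
        - (x - m).ofLp ⬝ᵥ S⁻¹ *ᵥ (x - m).ofLp / 2 := by
    simp only [dotProduct, mulVec]
    fun_prop
  obtain ⟨hac, hllr⟩ := llr_withDensity_exp (hmeas m₁ S₁) (hmeas m₂ S₂)
    (multivariateGaussian_eq_withDensity m₁ hS₁) (multivariateGaussian_eq_withDensity m₂ hS₂)
  obtain ⟨hi₁, h₁⟩ := integral_quadratic_multivariateGaussian m₁ m₁ hS₁.posSemidef S₁⁻¹
  obtain ⟨hi₂, h₂⟩ := integral_quadratic_multivariateGaussian m₁ m₂ hS₁.posSemidef S₂⁻¹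
  have hc := integrable_const (μ := multivariateGaussian m₁ S₁)
    (Real.log S₂.det / 2 - Real.log S₁.det / 2)
  have hllr' : llr (multivariateGaussian m₁ S₁) (multivariateGaussian m₂ S₂)
      =ᵐ[multivariateGaussian m₁ S₁] fun x => (Real.log S₂.det / 2 - Real.log S₁.det / 2)
        + (x - m₂).ofLp ⬝ᵥ S₂⁻¹ *ᵥ (x - m₂).ofLp / 2
        - (x - m₁).ofLp ⬝ᵥ S₁⁻¹ *ᵥ (x - m₁).ofLp / 2 := by
    filter_upwards [hllr] with x hx
    rw [hx]
    ring
  have hint := ((hc.add (hi₂.div_const 2)).sub (hi₁.div_const 2)).congr hllr'.symm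
  rw [← ENNReal.ofReal_toReal (InformationTheory.klDiv_ne_top hac hint),
    InformationTheory.toReal_klDiv_of_measure_eq hac (by simp), integral_congr_ae hllr',
    integral_sub (by exact hc.add (hi₂.div_const 2)) (hi₁.div_const 2),
    integral_add hc (hi₂.div_const 2), integral_div, integral_div, h₁, h₂,
    Matrix.nonsing_inv_mul _ hS₁.det_pos.ne'.isUnit]
  congr 1
  simp
  ring

/-! ### Spectral and Cauchy-Schwarz bounds for matrices -/

open Matrix Unitary in
theorem Matrix.IsHermitian.exists_eq_mul_diagonal_mul_transpose {n : Type*} [Fintype n]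
    [DecidableEq n] {A : Matrix n n ℝ} (hA : A.IsHermitian) :
    ∃ U : Matrix n n ℝ, U * Uᵀ = 1 ∧ Uᵀ * U = 1 ∧ A = U * diagonal hA.eigenvalues * Uᵀ := by
  refine ⟨hA.eigenvectorUnitary, ?_, ?_, ?_⟩
  · exact Unitary.coe_mul_star_self hA.eigenvectorUnitary
  · exact Unitary.coe_star_mul_self hA.eigenvectorUnitary
  · conv_lhs => rw [hA.spectral_theorem, conjStarAlgAut_apply]
    rfl

open Matrix in
theorem Matrix.PosDef.trace_sub_log_det_eq_sum {n : Type*} [Fintype n] [DecidableEq n]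
    {A : Matrix n n ℝ} (hA : A.PosDef) :
    A.trace - Real.log A.det - Fintype.card n
      = ∑ i, (hA.isHermitian.eigenvalues i - 1 - Real.log (hA.isHermitian.eigenvalues i)) := by
  rw [hA.isHermitian.trace_eq_sum_eigenvalues, hA.isHermitian.det_eq_prod_eigenvalues]
  simp only [RCLike.ofReal_real_eq_id, id]
  rw [Real.log_prod fun i _ => (hA.eigenvalues_pos i).ne']
  simp [Finset.sum_sub_distrib]
  ring

theorem Matrix.PosDef.trace_sub_log_det_nonneg {n : Type*} [Fintype n] [DecidableEq n]
    {A : Matrix n n ℝ} (hA : A.PosDef) : 0 ≤ A.trace - Real.log A.det - Fintype.card n := by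
  rw [hA.trace_sub_log_det_eq_sum]
  exact Finset.sum_nonneg fun i _ => sub_log_nonneg (hA.eigenvalues_pos i)

-- Diagonalizing A turns the hypothesis into the scalar one of `sum_sub_one_sq_le` for its
-- eigenvalues.
open Matrix in
theorem Matrix.PosDef.bounds_of_trace_sub_log_det_le {n : Type*} [Fintype n] [DecidableEq n]
    {A : Matrix n n ℝ} (hA : A.PosDef) {a : ℝ} (ha : 1 ≤ a)
    (h : A.trace - Real.log A.det - Fintype.card n ≤ a - 1 - Real.log a) :
    (∀ x, x ⬝ᵥ A *ᵥ x ≤ a * (x ⬝ᵥ x)) ∧ ((A - 1) * (A - 1)).trace ≤ (a - 1) ^ 2 := by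
  rw [hA.trace_sub_log_det_eq_sum] at h
  obtain ⟨hle, hsum⟩ := sum_sub_one_sq_le ha hA.eigenvalues_pos h
  obtain ⟨U, hU, hU', hAU⟩ := hA.isHermitian.exists_eq_mul_diagonal_mul_transpose
  set l := hA.isHermitian.eigenvalues
  constructor
  · intro x
    have h1 : x ⬝ᵥ A *ᵥ x = (Uᵀ *ᵥ x) ⬝ᵥ diagonal l *ᵥ (Uᵀ *ᵥ x) := by
      rw [hAU, ← mulVec_mulVec, ← mulVec_mulVec, dotProduct_mulVec, mulVec_transpose]
    have h2 : x ⬝ᵥ x = (Uᵀ *ᵥ x) ⬝ᵥ (Uᵀ *ᵥ x) := by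
      rw [dotProduct_mulVec, vecMul_transpose, mulVec_mulVec, hU, one_mulVec]
    rw [h1, h2]
    simp only [dotProduct, mulVec_diagonal, Finset.mul_sum]
    refine Finset.sum_le_sum fun i _ => ?_
    nlinarith [mul_le_mul_of_nonneg_right (hle i) (mul_self_nonneg ((Uᵀ *ᵥ x) i))]
  · have h1 : A - 1 = U * diagonal (fun i => l i - 1) * Uᵀ := by
      have : diagonal (fun i => l i - 1) = diagonal l - 1 := by
        rw [← diagonal_one, diagonal_sub]
      rw [this, mul_sub, sub_mul, mul_one, hU, ← hAU]
    have h2 : ((A - 1) * (A - 1)).trace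
        = (diagonal (fun i => l i - 1) * diagonal (fun i => l i - 1)).trace := by
      rw [h1, show U * diagonal (fun i => l i - 1) * Uᵀ * (U * diagonal (fun i => l i - 1) * Uᵀ)
        = U * (diagonal (fun i => l i - 1) * (Uᵀ * U) * diagonal (fun i => l i - 1) * Uᵀ) by
          simp only [mul_assoc], trace_mul_comm, hU', mul_one, mul_assoc, hU', mul_one]
    rw [h2, diagonal_mul_diagonal, trace_diagonal]
    simpa [sq] using hsum

open Matrix in
theorem Matrix.IsHermitian.trace_mul_sq_le {n : Type*} [Fintype n] {X Y : Matrix n n ℝ}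
    (hX : X.IsHermitian) (hY : Y.IsHermitian) :
    (X * Y).trace ^ 2 ≤ (X * X).trace * (Y * Y).trace := by
  have hs {Z : Matrix n n ℝ} (hZ : Z.IsHermitian) (i j : n) : Z j i = Z i j := by
    simpa using hZ.apply i j
  have h {W Z : Matrix n n ℝ} (hZ : Z.IsHermitian) :
      (W * Z).trace = ∑ p : n × n, W p.1 p.2 * Z p.1 p.2 := by
    simp only [trace, diag_apply, mul_apply, Fintype.sum_prod_type]
    exact Finset.sum_congr rfl fun i _ => Finset.sum_congr rfl fun j _ => by rw [hs hZ]
  rw [h hY, h hX, h hY]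
  simpa only [sq] using Finset.sum_mul_sq_le_sq_mul_sq Finset.univ
    (fun p : n × n => X p.1 p.2) (fun p => Y p.1 p.2)

open Matrix in
open scoped MatrixOrder in
theorem Matrix.PosDef.dotProduct_mulVec_sq_le {n : Type*} [Fintype n] [DecidableEq n]
    {B : Matrix n n ℝ} (hB : B.PosDef) (u v : n → ℝ) :
    (u ⬝ᵥ B *ᵥ v) ^ 2 ≤ (u ⬝ᵥ B *ᵥ u) * (v ⬝ᵥ B *ᵥ v) := by
  obtain ⟨hsymm, hsq, -⟩ := hB.cfcSqrt_spec
  set R := CFC.sqrt B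
  have h (x y : n → ℝ) : x ⬝ᵥ B *ᵥ y = ∑ i, (R *ᵥ x) i * (R *ᵥ y) i := by
    rw [← hsq, ← mulVec_mulVec, dotProduct_mulVec, ← mulVec_transpose, hsymm]
    rfl
  rw [h, h, h]
  simpa only [sq] using Finset.sum_mul_sq_le_sq_mul_sq Finset.univ (R *ᵥ u) (R *ᵥ v)

/-! ### The relaxed triangle inequality -/

/-- Used with p = |u|², t = vᵀBv, s = uᵀBu, c = uᵀBv. Here s + t + 2c ≤ (√s + √t)², which is at most
the right side; subtracting p + t makes the inequality strict. -/
theorem sq_add_sub_lt {a p t s c ε₁ ε₂ b : ℝ} (ha : 1 ≤ a) (hp : 0 ≤ p) (ht : 0 ≤ t)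
    (hs : 0 ≤ s) (hε : 0 < ε₁ + ε₂) (hε₂ : 0 ≤ ε₂) (hpε : p ≤ 2 * ε₁) (htε : t ≤ 2 * ε₂)
    (hsp : s ≤ a * p) (hc : c ^ 2 ≤ s * t) (hb : 0 < b) (hb1 : b ≤ 1) :
    s + t + 2 * c - p - t < a * (√(2 * ε₁) + √(2 * ε₂ / b)) ^ 2 := by
  have hK : 1 ≤ √a := Real.one_le_sqrt.2 ha
  have hK2 : √a ^ 2 = a := Real.sq_sqrt (by linarith)
  have hX : √p ≤ √(2 * ε₁) := Real.sqrt_le_sqrt hpε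
  have hY : √t ≤ √(2 * ε₂ / b) :=
    Real.sqrt_le_sqrt (htε.trans (le_div_self (by linarith) hb hb1))
  have hc' : c ≤ √s * √t := by
    rw [← Real.sqrt_mul hs]
    exact Real.le_sqrt_of_sq_le hc
  have hs' : √s ≤ √a * √p := by
    rw [← Real.sqrt_mul (by linarith)]
    exact Real.sqrt_le_sqrt hsp
  have h0 := Real.sqrt_nonneg p
  have h1 := Real.sqrt_nonneg t
  have h2 := Real.sqrt_nonneg s
  have h3 : √s + √t ≤ √a * (√(2 * ε₁) + √(2 * ε₂ / b)) := by
    nlinarith [mul_le_mul_of_nonneg_left hX (zero_le_one.trans hK),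
      mul_le_mul_of_nonneg_right hK (h1.trans hY)]
  have h4 : (√s + √t) ^ 2 ≤ a * (√(2 * ε₁) + √(2 * ε₂ / b)) ^ 2 := by
    rw [← hK2, ← mul_pow]
    exact pow_le_pow_left₀ (by positivity) h3 2
  have h5 : s + t + 2 * c ≤ (√s + √t) ^ 2 := by
    nlinarith [Real.sq_sqrt hs, Real.sq_sqrt ht]
  -- If p + t = 0, the left side vanishes and strictness comes from ε₁ + ε₂ > 0 instead.
  rcases (add_nonneg hp ht).eq_or_lt with h6 | h6
  · have hp0 : p = 0 := by linarith
    have ht0 : t = 0 := by linarith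
    have hs0 : s = 0 := by rw [hp0] at hsp; linarith
    have hc0 : c = 0 := by
      rw [hs0, zero_mul] at hc
      exact pow_eq_zero_iff two_ne_zero |>.1 (le_antisymm hc (sq_nonneg c))
    have hpos : 0 < √(2 * ε₁) + √(2 * ε₂ / b) := by
      rcases hε₂.eq_or_lt with h | h
      · have : 0 < √(2 * ε₁) := Real.sqrt_pos.2 (by linarith)
        positivity
      · have : 0 < √(2 * ε₂ / b) := Real.sqrt_pos.2 (by positivity)
        positivity
    have : 0 < a * (√(2 * ε₁) + √(2 * ε₂ / b)) ^ 2 := by positivity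
    rw [hp0, ht0, hs0, hc0]
    linarith
  · linarith

open Matrix in
theorem relaxed_triangle_of_posDef {n : Type*} [Fintype n] [DecidableEq n] {A B : Matrix n n ℝ}
    (hA : A.PosDef) (hB : B.PosDef) (u v : n → ℝ) {ε₁ ε₂ a₁ a₂ b : ℝ} (hε : 0 < ε₁ + ε₂)
    (hε₂ : 0 ≤ ε₂) (ha₁ : 1 ≤ a₁) (ha₂ : 1 ≤ a₂) (hf₁ : a₁ - 1 - Real.log a₁ = 2 * ε₁)
    (hf₂ : a₂ - 1 - Real.log a₂ = 2 * ε₂) (hb : 0 < b) (hb1 : b ≤ 1)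
    (h₁ : A.trace - Real.log A.det - Fintype.card n + u ⬝ᵥ u ≤ 2 * ε₁)
    (h₂ : B.trace - Real.log B.det - Fintype.card n + v ⬝ᵥ B *ᵥ v ≤ 2 * ε₂) :
    (B * A).trace - Real.log A.det - Real.log B.det - Fintype.card n + (u + v) ⬝ᵥ B *ᵥ (u + v)
      < 2 * ε₁ + 2 * ε₂ + (a₁ - 1) * (a₂ - 1) + a₂ * (√(2 * ε₁) + √(2 * ε₂ / b)) ^ 2 := by
  have hu : 0 ≤ u ⬝ᵥ u := Finset.sum_nonneg fun i _ => mul_self_nonneg _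
  have hq (x : n → ℝ) : 0 ≤ x ⬝ᵥ B *ᵥ x := by simpa using hB.posSemidef.dotProduct_mulVec_nonneg x
  obtain ⟨-, hA2⟩ := hA.bounds_of_trace_sub_log_det_le ha₁ (by linarith)
  obtain ⟨hBle, hB2⟩ := hB.bounds_of_trace_sub_log_det_le ha₂ (by linarith [hq v])
  have hA0 := hA.trace_sub_log_det_nonneg
  have hB0 := hB.trace_sub_log_det_nonneg
  have htr : ((B - 1) * (A - 1)).trace ≤ (a₁ - 1) * (a₂ - 1) := by
    have h := (hB.isHermitian.sub isHermitian_one).trace_mul_sq_le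
      (hA.isHermitian.sub isHermitian_one)
    have hnn : 0 ≤ ((A - 1) * (A - 1)).trace := by
      have := (posSemidef_conjTranspose_mul_self (A - 1)).trace_nonneg
      rwa [(hA.isHermitian.sub isHermitian_one).eq] at this
    refine (abs_le_of_sq_le_sq' (h.trans ?_)
      (mul_nonneg (sub_nonneg.2 ha₁) (sub_nonneg.2 ha₂))).2
    rw [mul_pow, mul_comm]
    exact mul_le_mul hA2 hB2 (by
      have := (posSemidef_conjTranspose_mul_self (B - 1)).trace_nonneg
      rwa [(hB.isHermitian.sub isHermitian_one).eq] at this) (sq_nonneg _)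
  have hexp : ((B - 1) * (A - 1)).trace = (B * A).trace - A.trace - B.trace + Fintype.card n := by
    rw [sub_mul, mul_sub, one_mul, mul_one]
    simp only [trace_sub, trace_one]
    ring
  have hcomm : v ⬝ᵥ B *ᵥ u = u ⬝ᵥ B *ᵥ v := by
    rw [dotProduct_mulVec, ← mulVec_transpose, dotProduct_comm,
      ← conjTranspose_eq_transpose_of_trivial, hB.isHermitian.eq]
  have hquad : (u + v) ⬝ᵥ B *ᵥ (u + v)
      = u ⬝ᵥ B *ᵥ u + v ⬝ᵥ B *ᵥ v + 2 * (u ⬝ᵥ B *ᵥ v) := by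
    rw [mulVec_add, add_dotProduct, dotProduct_add, dotProduct_add, hcomm]
    ring
  have := sq_add_sub_lt ha₂ hu (hq v) (hq u) hε hε₂ (by linarith) (by linarith) (hBle u)
    (hB.dotProduct_mulVec_sq_le u v) hb hb1
  rw [hquad]
  linarith

-- Whitening by √S₂ reduces to the case S₂ = 1: traces are cyclic, and the log-determinants of √S₂
-- cancel.
open Matrix in
open scoped MatrixOrder in
theorem relaxed_triangle_gaussian_parameters {n : Type*} [Fintype n] [DecidableEq n]
    {S₁ S₂ S₃ : Matrix n n ℝ} (hS₁ : S₁.PosDef) (hS₂ : S₂.PosDef) (hS₃ : S₃.PosDef)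
    (d e : n → ℝ) {ε₁ ε₂ a₁ a₂ b : ℝ} (hε : 0 < ε₁ + ε₂)
    (hε₂ : 0 ≤ ε₂) (ha₁ : 1 ≤ a₁) (ha₂ : 1 ≤ a₂) (hf₁ : a₁ - 1 - Real.log a₁ = 2 * ε₁)
    (hf₂ : a₂ - 1 - Real.log a₂ = 2 * ε₂) (hb : 0 < b) (hb1 : b ≤ 1)
    (h₁ : Real.log S₂.det - Real.log S₁.det + (S₂⁻¹ * S₁).trace - Fintype.card n
      + d ⬝ᵥ S₂⁻¹ *ᵥ d ≤ 2 * ε₁)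
    (h₂ : Real.log S₃.det - Real.log S₂.det + (S₃⁻¹ * S₂).trace - Fintype.card n
      + e ⬝ᵥ S₃⁻¹ *ᵥ e ≤ 2 * ε₂) :
    Real.log S₃.det - Real.log S₁.det + (S₃⁻¹ * S₁).trace - Fintype.card n
      + (d + e) ⬝ᵥ S₃⁻¹ *ᵥ (d + e)
      < 2 * ε₁ + 2 * ε₂ + (a₁ - 1) * (a₂ - 1) + a₂ * (√(2 * ε₁) + √(2 * ε₂ / b)) ^ 2 := by
  obtain ⟨hsymm, hsq, hdet⟩ := hS₂.cfcSqrt_spec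
  set R := CFC.sqrt S₂
  have hu : IsUnit R.det := hdet.ne'.isUnit
  have hRT : Rᴴ = R := by rw [conjTranspose_eq_transpose_of_trivial, hsymm]
  have hRiT : (R⁻¹)ᵀ = R⁻¹ := by rw [transpose_nonsing_inv, hsymm]
  have hRiH : (R⁻¹)ᴴ = R⁻¹ := by rw [conjTranspose_eq_transpose_of_trivial, hRiT]
  have hRunit : IsUnit R := (isUnit_iff_isUnit_det R).2 hu
  have hinv : S₂⁻¹ = R⁻¹ * R⁻¹ := by rw [← hsq, Matrix.mul_inv_rev]
  have hA : (R⁻¹ * S₁ * R⁻¹).PosDef := by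
    have := hS₁.mul_mul_conjTranspose_same (B := R⁻¹)
      (vecMul_injective_of_isUnit ((isUnit_nonsing_inv_iff).2 hRunit))
    rwa [hRiH] at this
  have hB : (R * S₃⁻¹ * R).PosDef := by
    have := hS₃.inv.mul_mul_conjTranspose_same (B := R) (vecMul_injective_of_isUnit hRunit)
    rwa [hRT] at this
  have htA : (R⁻¹ * S₁ * R⁻¹).trace = (S₂⁻¹ * S₁).trace := by
    rw [trace_mul_comm, hinv, mul_assoc, ← mul_assoc]
  have htB : (R * S₃⁻¹ * R).trace = (S₃⁻¹ * S₂).trace := by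
    rw [mul_assoc, trace_mul_comm, mul_assoc, hsq]
  have htBA : (R * S₃⁻¹ * R * (R⁻¹ * S₁ * R⁻¹)).trace = (S₃⁻¹ * S₁).trace := by
    rw [show R * S₃⁻¹ * R * (R⁻¹ * S₁ * R⁻¹) = R * (S₃⁻¹ * (R * R⁻¹) * S₁ * R⁻¹) by
      simp only [mul_assoc], trace_mul_comm, mul_nonsing_inv _ hu, mul_one, mul_assoc,
      nonsing_inv_mul _ hu, mul_one]
  have hlS₂ : Real.log S₂.det = 2 * Real.log R.det := by
    rw [← hsq, det_mul, Real.log_mul hdet.ne' hdet.ne']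
    ring
  have hlA : Real.log (R⁻¹ * S₁ * R⁻¹).det = Real.log S₁.det - Real.log S₂.det := by
    have h := inv_ne_zero hdet.ne'
    rw [det_mul, det_mul, det_nonsing_inv, Ring.inverse_eq_inv',
      Real.log_mul (mul_ne_zero h hS₁.det_pos.ne') h, Real.log_mul h hS₁.det_pos.ne', Real.log_inv,
      hlS₂]
    ring
  have hlB : Real.log (R * S₃⁻¹ * R).det = Real.log S₂.det - Real.log S₃.det := by
    have h := inv_ne_zero hS₃.det_pos.ne'
    rw [det_mul, det_mul, det_nonsing_inv, Ring.inverse_eq_inv',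
      Real.log_mul (mul_ne_zero hdet.ne' h) hdet.ne', Real.log_mul hdet.ne' h, Real.log_inv,
      hlS₂]
    ring
  have hself (x : n → ℝ) : (R⁻¹ *ᵥ x) ⬝ᵥ (R⁻¹ *ᵥ x) = x ⬝ᵥ S₂⁻¹ *ᵥ x := by
    rw [hinv, ← mulVec_mulVec, dotProduct_mulVec x, ← mulVec_transpose, hRiT]
  have hquad (x : n → ℝ) :
      (R⁻¹ *ᵥ x) ⬝ᵥ (R * S₃⁻¹ * R) *ᵥ (R⁻¹ *ᵥ x) = x ⬝ᵥ S₃⁻¹ *ᵥ x := by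
    rw [mulVec_mulVec, mul_assoc, mul_nonsing_inv _ hu, mul_one, ← mulVec_mulVec,
      dotProduct_mulVec, ← mulVec_transpose, hsymm, mulVec_mulVec, mul_nonsing_inv _ hu,
      one_mulVec]
  have key := relaxed_triangle_of_posDef hA hB (R⁻¹ *ᵥ d) (R⁻¹ *ᵥ e) hε hε₂ ha₁ ha₂ hf₁ hf₂ hb hb1
    (by rw [htA, hlA, hself]; linarith) (by rw [htB, hlB, hquad]; linarith)
  rw [htBA, hlA, hlB, ← mulVec_add, hquad] at key
  linarith

theorem theorem4 (n : ℕ) (μ₁ μ₂ μ₃ : EuclideanSpace ℝ (Fin n))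
    (S₁ S₂ S₃ : Matrix (Fin n) (Fin n) ℝ)
    (hS₁ : S₁.PosDef) (hS₂ : S₂.PosDef) (hS₃ : S₃.PosDef)
    (ε₁ ε₂ : ℝ) (hε₁ : 0 ≤ ε₁) (hε₂ : 0 ≤ ε₂) (hε : 0 < ε₁ + ε₂)
    (h₁₂ : InformationTheory.klDiv (ProbabilityTheory.multivariateGaussian μ₁ S₁)
      (ProbabilityTheory.multivariateGaussian μ₂ S₂) ≤ ENNReal.ofReal ε₁)
    (h₂₃ : InformationTheory.klDiv (ProbabilityTheory.multivariateGaussian μ₂ S₂)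
      (ProbabilityTheory.multivariateGaussian μ₃ S₃) ≤ ENNReal.ofReal ε₂) :
    InformationTheory.klDiv (ProbabilityTheory.multivariateGaussian μ₁ S₁)
      (ProbabilityTheory.multivariateGaussian μ₃ S₃) <
    ENNReal.ofReal (ε₁ + ε₂ + 1 / 2 *
      (lambertWNegOne (-Real.exp (-(1 + 2 * ε₁))) * lambertWNegOne (-Real.exp (-(1 + 2 * ε₂)))
        + lambertWNegOne (-Real.exp (-(1 + 2 * ε₁))) + lambertWNegOne (-Real.exp (-(1 + 2 * ε₂)))
        + 1
        - lambertWNegOne (-Real.exp (-(1 + 2 * ε₂))) *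
          (Real.sqrt (2 * ε₁) +
            Real.sqrt (2 * ε₂ / -lambertW0 (-Real.exp (-(1 + 2 * ε₂))))) ^ 2)) := by
  obtain ⟨ha₁, hf₁⟩ := lambertWNegOne_spec (T := 2 * ε₁) (by linarith)
  obtain ⟨ha₂, hf₂⟩ := lambertWNegOne_spec (T := 2 * ε₂) (by linarith)
  obtain ⟨hb, hb1⟩ := lambertW0_mem (T := 2 * ε₂) (by linarith)
  rw [klDiv_multivariateGaussian _ _ hS₁ hS₂, ENNReal.ofReal_le_ofReal_iff hε₁] at h₁₂
  rw [klDiv_multivariateGaussian _ _ hS₂ hS₃, ENNReal.ofReal_le_ofReal_iff hε₂] at h₂₃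
  have key := relaxed_triangle_gaussian_parameters hS₁ hS₂ hS₃ (μ₁ - μ₂).ofLp (μ₂ - μ₃).ofLp hε hε₂
    ha₁ ha₂ hf₁ hf₂ hb hb1 (by linarith) (by linarith)
  have hd : (μ₁ - μ₂).ofLp + (μ₂ - μ₃).ofLp = (μ₁ - μ₃).ofLp := by
    rw [← WithLp.ofLp_add, sub_add_sub_cancel]
  rw [hd] at key
  rw [klDiv_multivariateGaussian _ _ hS₁ hS₃, ENNReal.ofReal_lt_ofReal_iff]
  · linarith
  -- A strict comparison through `ENNReal.ofReal` requires the right side to be positive; the braces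
  -- equal (a₁-1)(a₂-1) plus a nonnegative term.
  · have h := mul_nonneg (sub_nonneg.2 ha₁) (sub_nonneg.2 ha₂)
    have h' := mul_nonneg (zero_le_one.trans ha₂) (sq_nonneg (√(2 * ε₁) +
      √(2 * ε₂ / -lambertW0 (-Real.exp (-(1 + 2 * ε₂))))))
    linarith
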